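/- Call a function $f:[0,\infty)\to\mathbb R$ log-concave if $f\ge 0$ and $f(\lambda x+(1-\lambda)y)\ge f(x)^{\lambda}f(y)^{1-\lambda}$ for all $x,y\ge 0$, $0<\lambda<1$. A measure on $[0,\infty)$ is called log-concave if it is either of the form $c\,\delta_{x_0}$ with $c\ge 0$, $x_0\ge 0$, or has a density (with respect to Lebesgue measure on $[0,\infty)$) that is a log-concave function. For a finite Borel measure $\mu$ on $[0,\infty)$ put $$F_\mu(t)=\int_0^\infty e^{-itx}\,d\mu(x)\quad(t\in\mathbb R),\qquad a_t(j)=\int_0^\infty \frac{x^j}{j!}e^{-tx}\,d\mu(x)\quad(t>0,\ j\ge 0).$$ Proposition. Let $\mu$ be a finite, log-concave measure on $[0,\infty)$. Then $F_\mu$ is $C^\infty$-smooth on $\mathbb R$, and for any non-negative integers $k\le\ell\le m\le n$ with $k+n=\ell+m$ there exists a finite, non-negative Borel measure $\nu=\nu_{k,\ell,m,n}$ on $[0,\infty)$ such that for all $t>0$, $$\int_0^\infty e^{-tx}\,d\nu(x)=a_t(\ell)a_t(m)-a_t(k)a_t(n);$$ this measure is unique (it is called the Berwald–Borell transform of $\mu$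 with parameters $(k,\ell,m,n)$), and it satisfies, for all $t\in\mathbb R$, $$\frac{F_\mu^{(\ell)}(t)}{\ell!}\frac{F_\mu^{(m)}(t)}{m!}-\frac{F_\mu^{(k)}(t)}{k!}\frac{F_\mu^{(n)}(t)}{n!}=(-i)^{\ell+m}F_\nu(t).$$ -/

import Mathlib

open MeasureTheory

/-- A function `f` is log-concave on a set `K ⊆ ℝ` (in applications a convex set): it is
non-negative on `K` and `f (s x + (1 - s) y) ≥ f x ^ s * f y ^ (1 - s)` for `x, y ∈ K`, `0 < s < 1`. -/
def LogConcaveFunOn (K : Set ℝ) (f : ℝ → ℝ) : Prop :=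
  (∀ x ∈ K, 0 ≤ f x) ∧
  ∀ x ∈ K, ∀ y ∈ K, ∀ s : ℝ, 0 < s → s < 1 →
    f x ^ s * f y ^ (1 - s) ≤ f (s * x + (1 - s) * y)

/-- Log-concave measures on `[0, ∞)`, regarded as Borel measures on `ℝ` that do not charge the
negative half-line: either a non-negative multiple of a delta measure at a point of `[0, ∞)`, or a
measure with a log-concave density on `[0, ∞)`. The values of `f` outside `[0, ∞)` play no role. -/
def IsLogConcaveMeasure (μ : Measure ℝ) : Prop :=
  (∃ (c : NNReal) (x₀ : ℝ), 0 ≤ x₀ ∧ μ = c • Measure.dirac x₀) ∨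
  ∃ f : ℝ → ℝ, LogConcaveFunOn (Set.Ici 0) f ∧
    μ = (volume.restrict (Set.Ici 0)).withDensity (fun x => ENNReal.ofReal (f x))

/-- The coefficient `a_t(j) = ∫ (x ^ j / j!) e^{-t x} dμ(x)`, for `μ` living on `[0, ∞)`. -/
noncomputable def taylorCoeff (μ : Measure ℝ) (t : ℝ) (j : ℕ) : ℝ :=
  ∫ x, x ^ j / (j.factorial : ℝ) * Real.exp (-(t * x)) ∂μ

/-- `ν` is a Berwald-Borell transform of `μ` with parameters `(k, l, m, n)`: a finite measure
on `[0, ∞)` whose Laplace transform at every `t > 0` is `a_t(l) a_t(m) - a_t(k) a_t(n)`. -/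
structure IsBerwaldBorellTransform (μ : Measure ℝ) (k l m n : ℕ) (ν : Measure ℝ) : Prop where
  finite : IsFiniteMeasure ν
  neg_null : ν (Set.Iio 0) = 0
  laplace : ∀ t : ℝ, 0 < t →
    ∫ x, Real.exp (-(t * x)) ∂ν =
      taylorCoeff μ t l * taylorCoeff μ t m - taylorCoeff μ t k * taylorCoeff μ t n

/-- The Fourier transform `F_μ(t) = ∫ e^{-i t x} dμ(x)`, for `μ` living on `[0, ∞)`. -/
noncomputable def fourierMeasure (μ : Measure ℝ) (t : ℝ) : ℂ :=
  ∫ x, Complex.exp (-(Complex.I * (t : ℂ) * (x : ℂ))) ∂μ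

/-! Write μ_j for the measure x^j/j! dμ. Then a_t(j) is the Laplace transform of μ_j, F_μ^(j)/j! is
(-i)^j times its Fourier transform, and products of transforms come from convolutions. So ν has to
be μ_l ∗ μ_m - μ_k ∗ μ_n, and the point is its positivity
(`IsLogConcaveMeasure.momentMeasure_conv_le`).

For a density f, the convolution μ_i ∗ μ_j has at s > 0 the density ∫_0^s x^i/i! (s-x)^j/j! f(x)
f(s-x) dx. Without the factor f(x) f(s-x) this depends only on i + j, so the two kernels have equal
mass. Symmetrised under x ↦ s - x, the ratio of the (l, m) kernel to the (k, n) kernel increases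
with x(s-x) (`mixed_pow_mul_le`); by log-concavity so does f(x) f(s-x)
(`LogConcaveFunOn.mul_le_mul_of_add_eq`). Chebyshev's inequality concludes. For a point mass only
factorials are compared.

Exponential decay of f gives all moments, hence smoothness; uniqueness follows by analytic
continuation of the Laplace transform. -/

/-! ### Uniqueness of the Laplace transform on the half-line. -/

theorem exp_mul_le_one_of_nonneg {x t : ℝ} (hx : 0 ≤ x) (ht : t ≤ 0) : Real.exp (t * x) ≤ 1 :=
  Real.exp_le_one_iff.2 (mul_nonpos_of_nonpos_of_nonneg ht hx)

theorem ae_nonneg_of_measure_Iio {μ : Measure ℝ} (h : μ (Set.Iio 0) = 0) : ∀ᵐ x ∂μ, 0 ≤ x := by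
  rw [ae_iff]; simpa [Set.Iio] using h

open ProbabilityTheory in
theorem Iic_subset_integrableExpSet {μ : Measure ℝ} [IsFiniteMeasure μ] (h : μ (Set.Iio 0) = 0) :
    Set.Iic 0 ⊆ integrableExpSet id μ := by
  intro t ht
  refine Integrable.of_bound (C := 1) (by fun_prop) ?_
  filter_upwards [ae_nonneg_of_measure_Iio h] with x hx
  rw [Real.norm_of_nonneg (Real.exp_nonneg _)]
  exact exp_mul_le_one_of_nonneg hx ht

open ProbabilityTheory in
/-- The boundary values of the Laplace transform on the imaginary axis. -/
theorem tendsto_complexMGF_charFun {μ : Measure ℝ} [IsFiniteMeasure μ] (h : μ (Set.Iio 0) = 0)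
    (t : ℝ) : Filter.Tendsto (fun r : ℝ => complexMGF id μ (r + t * Complex.I))
      (nhdsWithin 0 (Set.Iio 0)) (nhds (charFun μ t)) := by
  rw [← complexMGF_id_mul_I]
  refine tendsto_integral_filter_of_dominated_convergence (fun _ => 1)
    (Filter.Eventually.of_forall fun r => by fun_prop) ?_ (integrable_const _)
    (Filter.Eventually.of_forall fun x => ?_)
  · filter_upwards [self_mem_nhdsWithin] with r hr
    filter_upwards [ae_nonneg_of_measure_Iio h] with x hx
    rw [Complex.norm_exp]
    simpa using mul_nonpos_of_nonpos_of_nonneg (le_of_lt hr) hx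
  · have : Continuous fun r : ℝ => Complex.exp ((r + t * Complex.I) * (id x : ℝ)) := by fun_prop
    simpa using (this.tendsto 0).mono_left nhdsWithin_le_nhds

open ProbabilityTheory in
/-- Finite measures on the half-line with the same Laplace transform are equal. -/
theorem Measure.ext_of_laplace_eq {μ ν : Measure ℝ} [IsFiniteMeasure μ] [IsFiniteMeasure ν]
    (hμ : μ (Set.Iio 0) = 0) (hν : ν (Set.Iio 0) = 0)
    (h : ∀ t : ℝ, 0 < t → ∫ x, Real.exp (-(t * x)) ∂μ = ∫ x, Real.exp (-(t * x)) ∂ν) : μ = ν := by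
  have hmgf : ∀ r : ℝ, r < 0 → mgf id μ r = mgf id ν r := fun r hr => by
    simpa [mgf] using h (-r) (by linarith)
  have hana : ∀ ρ : Measure ℝ, IsFiniteMeasure ρ → ρ (Set.Iio 0) = 0 →
      AnalyticOnNhd ℂ (complexMGF id ρ) {z : ℂ | z.re < 0} := fun ρ _ hρ z hz =>
    analyticAt_complexMGF (interior_mono (Iic_subset_integrableExpSet hρ) (by simpa using hz))
  have heq : Set.EqOn (complexMGF id μ) (complexMGF id ν) {z : ℂ | z.re < 0} := by
    refine (hana μ inferInstance hμ).eqOn_of_preconnected_of_frequently_eq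
      (hana ν inferInstance hν) (convex_halfSpace_re_lt 0).isPreconnected (z₀ := ((-1 : ℝ) : ℂ))
      (by simp) ?_
    -- Agreement on the real axis near -1 gives the accumulation point needed by the identity
    -- theorem.
    have hreal : ∃ᶠ r : ℝ in nhdsWithin (-1) {-1}ᶜ,
        complexMGF id μ r = complexMGF id ν r := by
      refine Filter.Eventually.frequently ?_
      filter_upwards [nhdsWithin_le_nhds (Iio_mem_nhds (show (-1 : ℝ) < 0 by norm_num))] with r hr
      rw [complexMGF_ofReal, complexMGF_ofReal, hmgf r hr]
    refine Filter.Tendsto.frequently (f := fun r : ℝ => (r : ℂ)) ?_ hreal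
    refine tendsto_nhdsWithin_iff.2
      ⟨(Complex.continuous_ofReal.tendsto _).mono_left nhdsWithin_le_nhds, ?_⟩
    filter_upwards [self_mem_nhdsWithin] with r hr
    simpa only [Set.mem_compl_iff, Set.mem_singleton_iff, Complex.ofReal_inj] using hr
  refine Measure.ext_of_charFun (funext fun t => ?_)
  refine tendsto_nhds_unique (tendsto_complexMGF_charFun hμ t)
    ((tendsto_complexMGF_charFun hν t).congr' ?_)
  filter_upwards [self_mem_nhdsWithin] with r hr
  exact (heq (by simpa using hr)).symm

/-! ### Exponential decay of integrable log-concave functions. -/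

/-- Beyond y, the concave function log f lies below its chord through x and y, extended. -/
theorem LogConcaveFunOn.le_mul_rpow_of_lt {f : ℝ → ℝ} (hf : LogConcaveFunOn (Set.Ici 0) f) {x y z : ℝ}
    (hx : 0 ≤ x) (hxy : x < y) (hyz : y < z) (hlt : f y < f x) :
    f z ≤ f x * (f y / f x) ^ ((z - x) / (y - x)) := by
  have hfx : 0 < f x := (hf.1 y (hx.trans hxy.le)).trans_lt hlt
  have hfy : 0 ≤ f y := hf.1 y (hx.trans hxy.le)
  have hfz : 0 ≤ f z := hf.1 z (hx.trans (hxy.trans hyz).le)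
  have hxz : 0 < z - x := by linarith
  have hyx : 0 < y - x := by linarith
  set r := (y - x) / (z - x) with hr
  have hr0 : 0 < r := by positivity
  have hr1 : r < 1 := by rw [hr, div_lt_one hxz]; linarith
  have h := hf.2 z (hx.trans (hxy.trans hyz).le) x hx r hr0 hr1
  have e : r * z + (1 - r) * x = y := by rw [hr]; field_simp; ring
  rw [e] at h
  have h2 : (f z / f x) ^ r ≤ f y / f x := by
    rw [Real.div_rpow hfz hfx.le, div_le_div_iff₀ (by positivity) hfx]
    calc f z ^ r * f x = f z ^ r * f x ^ (1 - r) * f x ^ r := by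
          rw [mul_assoc, ← Real.rpow_add hfx]; simp
      _ ≤ f y * f x ^ r := by gcongr
  have h3 : f z / f x ≤ (f y / f x) ^ r⁻¹ := by
    have := Real.rpow_le_rpow (by positivity) h2 (inv_nonneg.2 hr0.le)
    rwa [← Real.rpow_mul (by positivity), mul_inv_cancel₀ hr0.ne', Real.rpow_one] at this
  rw [hr, inv_div] at h3
  rw [div_le_iff₀ hfx] at h3
  linarith

/-- An integrable log-concave function on the half-line decays exponentially. -/
theorem LogConcaveFunOn.exists_le_exp {f : ℝ → ℝ} (hf : LogConcaveFunOn (Set.Ici 0) f)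
    (hint : IntegrableOn f (Set.Ici 0)) :
    ∃ C c X : ℝ, 0 < c ∧ 0 ≤ X ∧ ∀ x, X < x → f x ≤ C * Real.exp (-c * x) := by
  -- A nonnegative nondecreasing integrable function on the half-line vanishes on (0, ∞), so C = 0
  -- serves.
  by_cases hmono : MonotoneOn f (Set.Ici 0)
  · refine ⟨0, 1, 0, one_pos, le_rfl, fun x hx => ?_⟩
    rw [zero_mul]
    by_contra! hpos
    have hconst : IntegrableOn (fun _ => f x) (Set.Ici x) := by
      refine Integrable.mono' (hint.mono_set (Set.Ici_subset_Ici.2 hx.le)) (by fun_prop) ?_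
      filter_upwards [ae_restrict_mem measurableSet_Ici] with y hy
      rw [Real.norm_of_nonneg hpos.le]
      exact hmono hx.le (hx.le.trans hy) hy
    rw [integrableOn_const_iff] at hconst
    simp [hpos.ne'] at hconst
  · simp only [MonotoneOn, not_forall, not_le] at hmono
    obtain ⟨x, hx, y, hy, hxy, hlt⟩ := hmono
    have hxy : x < y := lt_of_le_of_ne hxy fun h => by subst h; exact lt_irrefl _ hlt
    have hfy : 0 ≤ f y := hf.1 y hy
    have hfx : 0 < f x := hfy.trans_lt hlt
    -- The 1/2 covers f y = 0, where `Real.log 0 = 0` would give decay rate zero.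
    set q := max (f y / f x) (1 / 2) with hq
    have hq0 : 0 < q := lt_max_of_lt_right (by norm_num)
    have hq1 : q < 1 := max_lt ((div_lt_one hfx).2 hlt) (by norm_num)
    have hyx : 0 < y - x := by linarith
    have hlog : 0 < -Real.log q / (y - x) := div_pos (neg_pos.2 (Real.log_neg hq0 hq1)) hyx
    refine ⟨f x * Real.exp (-Real.log q / (y - x) * x), -Real.log q / (y - x), y, hlog, hy,
      fun z hz => (hf.le_mul_rpow_of_lt hx hxy hz hlt).trans ?_⟩
    rw [mul_assoc, ← Real.exp_add]
    refine mul_le_mul_of_nonneg_left ?_ hfx.le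
    calc (f y / f x) ^ ((z - x) / (y - x)) ≤ q ^ ((z - x) / (y - x)) :=
          Real.rpow_le_rpow (by positivity) (le_max_left _ _)
            (div_nonneg (by linarith) hyx.le)
      _ = _ := by
          rw [Real.rpow_def_of_pos hq0]
          congr 1
          ring

theorem LogConcaveFunOn.exists_integrableOn_mul_exp {f : ℝ → ℝ}
    (hf : LogConcaveFunOn (Set.Ici 0) f) (hint : IntegrableOn f (Set.Ici 0)) :
    ∃ c > 0, ∀ t < c, IntegrableOn (fun x => Real.exp (t * x) * f x) (Set.Ici 0) := by
  obtain ⟨C, c, X, hc, hX, h⟩ := hf.exists_le_exp hint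
  refine ⟨c, hc, fun t ht => ?_⟩
  rw [← Set.Icc_union_Ioi_eq_Ici hX]
  refine IntegrableOn.union ?_ ?_
  · exact (hint.mono_set Set.Icc_subset_Ici_self).continuousOn_mul (by fun_prop) isCompact_Icc
  · have hm : AEStronglyMeasurable (fun x => Real.exp (t * x) * f x)
        (volume.restrict (Set.Ioi X)) :=
      (Continuous.aestronglyMeasurable (by fun_prop)).mul
        (hint.mono_set (Set.Ioi_subset_Ici hX)).aestronglyMeasurable
    refine Integrable.mono' ((integrableOn_exp_mul_Ioi (sub_neg.2 ht) X).const_mul C) hm ?_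
    filter_upwards [ae_restrict_mem measurableSet_Ioi] with x hx
    rw [Real.norm_of_nonneg (mul_nonneg (Real.exp_nonneg _) (hf.1 x (hX.trans (le_of_lt hx))))]
    calc Real.exp (t * x) * f x ≤ Real.exp (t * x) * (C * Real.exp (-c * x)) := by
          gcongr; exact h x hx
      _ = C * Real.exp ((t - c) * x) := by
          rw [mul_left_comm, ← Real.exp_add]; ring_nf

/-! ### Monotonicity in x * y at fixed sum, and Chebyshev's inequality. -/

/-- A log-concave function decreases under spreading: among pairs with a fixed sum, the product
`f x * f y` is monotone in `x * y`. -/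
theorem LogConcaveFunOn.mul_le_mul_of_add_eq {f : ℝ → ℝ} (hf : LogConcaveFunOn (Set.Ici 0) f)
    {x y u v : ℝ} (hu : 0 ≤ u) (hv : 0 ≤ v) (hadd : x + y = u + v) (hmul : u * v ≤ x * y) :
    f u * f v ≤ f x * f y := by
  obtain ⟨h0, hlc⟩ := hf
  have key : ∀ s : ℝ, 0 ≤ s → s ≤ 1 → f u ^ s * f v ^ (1 - s) ≤ f (s * u + (1 - s) * v) := by
    intro s hs0 hs1
    rcases hs0.eq_or_lt with rfl | hs0
    · simp
    rcases hs1.eq_or_lt with rfl | hs1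
    · simp
    exact hlc u hu v hv s hs0 hs1
  -- The left side equals u * v - x * y. So x lies between u and v, and y has the complementary
  -- weights.
  have hbtw : (x - u) * (x - v) ≤ 0 := by
    have : y = u + v - x := by linarith
    subst this
    nlinarith
  by_cases huv : u = v
  · subst huv
    have hx : x = u := by nlinarith [sq_nonneg (x - u)]
    have hy : y = u := by linarith
    rw [hx, hy]
  have hne : u - v ≠ 0 := sub_ne_zero.2 huv
  set s := (x - v) / (u - v) with hs
  have hx : s * u + (1 - s) * v = x := by rw [hs]; field_simp; ring
  have hs' : s * (u - v) = x - v := by rw [hs]; field_simp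
  have hss : 0 ≤ s * (1 - s) := by
    have h1 : s * (1 - s) = -((x - u) * (x - v)) / (u - v) ^ 2 := by
      rw [hs]; field_simp; ring
    rw [h1]
    exact div_nonneg (by linarith) (sq_nonneg _)
  have hs0 : 0 ≤ s := by nlinarith [sq_nonneg s]
  have hs1 : s ≤ 1 := by nlinarith [sq_nonneg (1 - s)]
  have e1 := key s hs0 hs1
  have e2 := key (1 - s) (by linarith) (by linarith)
  have hy : (1 - s) * u + (1 - (1 - s)) * v = y := by linarith
  rw [hx] at e1
  rw [hy, sub_sub_cancel] at e2
  have hfu := h0 u hu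
  have hfv := h0 v hv
  calc f u * f v = (f u ^ s * f v ^ (1 - s)) * (f u ^ (1 - s) * f v ^ s) := by
        have a1 : f u ^ s * f u ^ (1 - s) = f u := by
          rw [← Real.rpow_add_of_nonneg hfu hs0 (by linarith)]; simp
        have a2 : f v ^ (1 - s) * f v ^ s = f v := by
          rw [← Real.rpow_add_of_nonneg hfv (by linarith) hs0]; simp
        calc f u * f v = (f u ^ s * f u ^ (1 - s)) * (f v ^ (1 - s) * f v ^ s) := by rw [a1, a2]
          _ = _ := by ring
    _ ≤ f x * f y := mul_le_mul e1 e2 (by positivity) (le_trans (by positivity) e1)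

theorem mul_sub_pow_nonneg {P Q U V : ℝ} (hP : 0 ≤ P) (hQ : 0 ≤ Q) (hU : 0 ≤ U) (hV : 0 ≤ V)
    (h : 0 < (V - U) * (P - Q)) (a b : ℕ) : 0 ≤ (V ^ b - U ^ b) * (P ^ a - Q ^ a) := by
  rcases pos_and_pos_or_neg_and_neg_of_mul_pos h with ⟨h1, h2⟩ | ⟨h1, h2⟩
  · exact mul_nonneg (sub_nonneg.2 (pow_le_pow_left₀ hU (by linarith) b))
      (sub_nonneg.2 (pow_le_pow_left₀ hQ (by linarith) a))
  · exact mul_nonneg_of_nonpos_of_nonpos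
      (sub_nonpos.2 (pow_le_pow_left₀ hV (by linarith) b))
      (sub_nonpos.2 (pow_le_pow_left₀ hP (by linarith) a))

/-- The ratio `(x ^ a * y ^ b + x ^ b * y ^ a) / (x ^ (a + b) + y ^ (a + b))` is monotone in
`x * y` when `x + y` is fixed. -/
theorem mixed_pow_mul_le {x y u v : ℝ} (hx : 0 ≤ x) (hy : 0 ≤ y) (hu : 0 ≤ u) (hv : 0 ≤ v)
    (hs : 0 < x + y) (hadd : x + y = u + v) (hmul : u * v < x * y) (a b : ℕ) :
    (u ^ a * v ^ b + u ^ b * v ^ a) * (x ^ (a + b) + y ^ (a + b)) ≤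
      (x ^ a * y ^ b + x ^ b * y ^ a) * (u ^ (a + b) + v ^ (a + b)) := by
  have h : 0 < (y * v - x * u) * (x * v - y * u) := by
    have : (y * v - x * u) * (x * v - y * u) = (x + y) ^ 2 * (x * y - u * v) := by
      have : v = x + y - u := by linarith
      subst this; ring
    rw [this]
    exact mul_pos (by positivity) (by linarith)
  -- Expanded, `h1` and its copy `h2` with a and b exchanged add up exactly to the difference of the
  -- two sides.
  have h1 := mul_sub_pow_nonneg (mul_nonneg hx hv) (mul_nonneg hy hu) (mul_nonneg hx hu)
    (mul_nonneg hy hv) h a b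
  have h2 := mul_sub_pow_nonneg (mul_nonneg hx hv) (mul_nonneg hy hu) (mul_nonneg hx hu)
    (mul_nonneg hy hv) h b a
  simp only [mul_pow] at h1 h2
  simp only [pow_add]
  linarith

/-- A weighted Chebyshev inequality: if `p / w` and `g` vary monotonically together and `p` has
integral zero, then `p * g` has nonnegative integral. -/
theorem integral_mul_nonneg_of_monovary {α : Type*} [MeasurableSpace α] {ρ : Measure α}
    {p w g : α → ℝ} (hp : Integrable p ρ) (hw : Integrable w ρ)
    (hpg : Integrable (fun x => p x * g x) ρ) (hwg : Integrable (fun x => w x * g x) ρ)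
    (h : ∀ᵐ x ∂ρ, ∀ᵐ y ∂ρ, 0 ≤ (p x * w y - p y * w x) * (g x - g y))
    (hp0 : ∫ x, p x ∂ρ = 0) (hw0 : 0 < ∫ x, w x ∂ρ) :
    0 ≤ ∫ x, p x * g x ∂ρ := by
  have inner : ∀ x, ∫ y, (p x * w y - p y * w x) * (g x - g y) ∂ρ =
      p x * g x * (∫ y, w y ∂ρ) - p x * (∫ y, w y * g y ∂ρ) + w x * ∫ y, p y * g y ∂ρ := by
    intro x
    have : ∀ y, (p x * w y - p y * w x) * (g x - g y) =
        p x * g x * w y - p x * (w y * g y) + w x * (p y * g y) - w x * g x * p y := by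
      intro y; ring
    simp_rw [this]
    have h1 : Integrable (fun y => p x * g x * w y - p x * (w y * g y)) ρ :=
      (hw.const_mul _).sub (hwg.const_mul _)
    have h2 : Integrable
        (fun y => p x * g x * w y - p x * (w y * g y) + w x * (p y * g y)) ρ :=
      h1.add (hpg.const_mul _)
    rw [integral_sub h2 (hp.const_mul _), integral_add h1 (hpg.const_mul _),
      integral_sub (hw.const_mul _) (hwg.const_mul _)]
    simp only [integral_const_mul, hp0]
    ring
  -- As p has integral zero, this double integral equals 2 (∫ w) (∫ p g).
  have outer : 0 ≤ ∫ x, (p x * g x * (∫ y, w y ∂ρ) - p x * (∫ y, w y * g y ∂ρ) +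
      w x * ∫ y, p y * g y ∂ρ) ∂ρ := by
    refine integral_nonneg_of_ae ?_
    filter_upwards [h] with x hx
    simp only [Pi.zero_apply]
    rw [← inner x]
    exact integral_nonneg_of_ae hx
  have h3 : Integrable
      (fun x => p x * g x * (∫ y, w y ∂ρ) - p x * (∫ y, w y * g y ∂ρ)) ρ :=
    (hpg.mul_const _).sub (hp.mul_const _)
  rw [integral_add h3 (hw.mul_const _),
    integral_sub (hpg.mul_const _) (hp.mul_const _)] at outer
  simp only [integral_mul_const, hp0] at outer
  nlinarith

/-! ### Beta integrals: equal mass of the kernels. -/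

/-- Integration by parts: the boundary term vanishes at 0 and at s because both exponents are
positive. -/
theorem intervalIntegral_pow_mul_sub_pow_succ (s : ℝ) (i j : ℕ) :
    ∫ x in (0 : ℝ)..s, x ^ (i + 1) / (i + 1).factorial * ((s - x) ^ j / j.factorial) =
      ∫ x in (0 : ℝ)..s, x ^ i / i.factorial * ((s - x) ^ (j + 1) / (j + 1).factorial) := by
  rw [← sub_eq_zero, ← intervalIntegral.integral_sub
    (Continuous.intervalIntegrable (by fun_prop) _ _)
    (Continuous.intervalIntegrable (by fun_prop) _ _)]
  have hd : ∀ x ∈ Set.uIcc 0 s, HasDerivAt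
      (fun x : ℝ => -(x ^ (i + 1) / (i + 1).factorial * ((s - x) ^ (j + 1) / (j + 1).factorial)))
      (x ^ (i + 1) / (i + 1).factorial * ((s - x) ^ j / j.factorial) -
        x ^ i / i.factorial * ((s - x) ^ (j + 1) / (j + 1).factorial)) x := by
    intro x _
    have h1 := (hasDerivAt_pow (i + 1) x).div_const ((i + 1).factorial : ℝ)
    have h2 := (((hasDerivAt_id x).const_sub s).pow (j + 1)).div_const ((j + 1).factorial : ℝ)
    convert! (h1.mul h2).neg using 1
    simp only [Nat.factorial_succ, Nat.cast_mul, id, Pi.pow_apply]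
    have a1 : (i.factorial : ℝ) ≠ 0 := by positivity
    have a2 : (j.factorial : ℝ) ≠ 0 := by positivity
    have a3 : ((i + 1 : ℕ) : ℝ) ≠ 0 := by positivity
    have a4 : ((j + 1 : ℕ) : ℝ) ≠ 0 := by positivity
    simp only [Nat.add_sub_cancel]
    field_simp
    ring
  rw [intervalIntegral.integral_eq_sub_of_hasDerivAt hd
    (Continuous.intervalIntegrable (by fun_prop) _ _)]
  simp

theorem intervalIntegral_pow_mul_sub_pow_eq (s : ℝ) (i j : ℕ) :
    ∫ x in (0 : ℝ)..s, x ^ i / i.factorial * ((s - x) ^ j / j.factorial) =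
      ∫ x in (0 : ℝ)..s, (s - x) ^ (i + j) / (i + j).factorial := by
  induction i generalizing j with
  | zero => simp
  | succ i ih =>
    rw [intervalIntegral_pow_mul_sub_pow_succ, ih]
    have : i + (j + 1) = i + 1 + j := by ring
    rw [this]

/-! ### The pointwise inequality between convolution densities. -/

/-- Superlevel sets of a log-concave function are convex, hence intervals. -/
theorem LogConcaveFunOn.measurable_indicator {f : ℝ → ℝ} (hf : LogConcaveFunOn (Set.Ici 0) f) :
    Measurable ((Set.Ici (0 : ℝ)).indicator f) := by
  refine measurable_of_Ici fun c => ?_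
  by_cases hc : c ≤ 0
  · convert MeasurableSet.univ
    refine Set.eq_univ_of_forall fun x => ?_
    exact hc.trans (Set.indicator_nonneg hf.1 x)
  push Not at hc
  have mem : ∀ x, x ∈ (Set.Ici (0 : ℝ)).indicator f ⁻¹' Set.Ici c ↔ 0 ≤ x ∧ c ≤ f x := by
    intro x
    by_cases hx : 0 ≤ x
    · simp [hx]
    · simp [Set.indicator, hx, hc]
  refine (Convex.ordConnected (𝕜 := ℝ) (convex_iff_forall_pos.2 ?_)).measurableSet
  intro x hx y hy a b ha hb hab
  rw [mem] at hx hy ⊢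
  obtain rfl : b = 1 - a := by linarith
  refine ⟨add_nonneg (smul_nonneg ha.le hx.1) (smul_nonneg hb.le hy.1), ?_⟩
  calc c = c ^ a * c ^ (1 - a) := by rw [← Real.rpow_add hc]; simp
    _ ≤ f x ^ a * f y ^ (1 - a) := by
        gcongr
        · exact Real.rpow_nonneg (hf.1 x hx.1) _
        · exact hx.2
        · exact hy.2
    _ ≤ _ := hf.2 x hx.1 y hy.1 a ha (by linarith)

/-- No integrability of f is needed: at fixed sum s the product is largest at the midpoint, so it is
bounded by f(s/2)^2. -/
theorem LogConcaveFunOn.integrable_mul_reflect {f : ℝ → ℝ} (hf : LogConcaveFunOn (Set.Ici 0) f)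
    (s : ℝ) {q : ℝ → ℝ} (hq : Continuous q) :
    Integrable (fun x => q x * (f x * f (s - x))) (volume.restrict (Set.Icc 0 s)) := by
  have hF := hf.measurable_indicator
  have hG : AEStronglyMeasurable (fun x => f x * f (s - x)) (volume.restrict (Set.Icc 0 s)) := by
    have h1 : Measurable (fun x => (Set.Ici (0 : ℝ)).indicator f x *
        (Set.Ici (0 : ℝ)).indicator f (s - x)) :=
      hF.mul (hF.comp (measurable_const.sub measurable_id))
    refine h1.aestronglyMeasurable.congr ?_
    filter_upwards [ae_restrict_mem measurableSet_Icc] with x hx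
    rw [Set.indicator_of_mem (show x ∈ Set.Ici (0 : ℝ) from hx.1),
      Set.indicator_of_mem (show s - x ∈ Set.Ici (0 : ℝ) from sub_nonneg.2 hx.2)]
  refine Integrable.mul_bdd (c := f (s / 2) * f (s / 2))
    (hq.continuousOn.integrableOn_compact isCompact_Icc) hG ?_
  filter_upwards [ae_restrict_mem measurableSet_Icc] with x hx
  have hx' : 0 ≤ s - x := sub_nonneg.2 hx.2
  rw [Real.norm_of_nonneg (mul_nonneg (hf.1 _ hx.1) (hf.1 _ hx'))]
  exact hf.mul_le_mul_of_add_eq hx.1 hx' (by ring) (by nlinarith [sq_nonneg (x - s / 2)])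

/-- Replacing the exponents `(k, k + a + b)` by `(k + a, k + b)` increases the convolution. -/
theorem LogConcaveFunOn.intervalIntegral_pow_mul_le {f : ℝ → ℝ}
    (hf : LogConcaveFunOn (Set.Ici 0) f) {s : ℝ} (hs : 0 < s) (k a b : ℕ) :
    ∫ x in (0 : ℝ)..s, x ^ k / k.factorial * ((s - x) ^ (k + a + b) / (k + a + b).factorial) *
        (f x * f (s - x)) ≤
      ∫ x in (0 : ℝ)..s, x ^ (k + a) / (k + a).factorial *
        ((s - x) ^ (k + b) / (k + b).factorial) * (f x * f (s - x)) := by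
  set A : ℝ := (k + a).factorial * (k + b).factorial with hA
  set B : ℝ := k.factorial * (k + a + b).factorial with hB
  have hA0 : 0 < A := by positivity
  have hB0 : 0 < B := by positivity
  set u : ℝ → ℝ := fun x => x ^ (k + a) / (k + a).factorial *
    ((s - x) ^ (k + b) / (k + b).factorial) with hu
  set v : ℝ → ℝ := fun x => x ^ k / k.factorial *
    ((s - x) ^ (k + a + b) / (k + a + b).factorial) with hv
  have huc : Continuous u := by fun_prop
  have hvc : Continuous v := by fun_prop
  have huc' : Continuous (fun x => u (s - x)) := by fun_prop
  have hvc' : Continuous (fun x => v (s - x)) := by fun_prop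
  -- Symmetrisation under x ↦ s - x makes w, p and g functions of x * (s - x) alone, which is what
  -- Chebyshev's inequality requires.
  set w : ℝ → ℝ := fun x => v x + v (s - x) with hw
  set p : ℝ → ℝ := fun x => u x + u (s - x) - w x with hp
  set g : ℝ → ℝ := fun x => f x * f (s - x) with hg
  have hwc : Continuous w := by fun_prop
  have hpc : Continuous p := by fun_prop
  have int : ∀ q : ℝ → ℝ, Continuous q →
      Integrable (fun x => q x * g x) (volume.restrict (Set.Icc 0 s)) :=
    fun q hq => hf.integrable_mul_reflect s hq
  have toI : ∀ q : ℝ → ℝ, ∫ x in Set.Icc 0 s, q x = ∫ x in (0 : ℝ)..s, q x := fun q => by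
    rw [intervalIntegral.integral_of_le hs.le, integral_Icc_eq_integral_Ioc]
  have refl : ∀ q : ℝ → ℝ, ∫ x in (0 : ℝ)..s, q (s - x) = ∫ x in (0 : ℝ)..s, q x := fun q => by
    rw [intervalIntegral.integral_comp_sub_left]; simp
  have gsymm : ∀ x, g (s - x) = g x := fun x => by simp [hg, mul_comm]
  have intI : ∀ q : ℝ → ℝ, Continuous q →
      IntervalIntegrable (fun x => q x * g x) volume 0 s := fun q hq => by
    rw [intervalIntegrable_iff_integrableOn_Icc_of_le hs.le]
    exact int q hq
  have hw_eq : ∀ x, w x = (x * (s - x)) ^ k * (x ^ (a + b) + (s - x) ^ (a + b)) / B := by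
    intro x
    simp only [hw, hv, hB, sub_sub_cancel, mul_pow]
    field_simp
    ring
  have hu_eq : ∀ x, u x + u (s - x) =
      (x * (s - x)) ^ k * (x ^ a * (s - x) ^ b + x ^ b * (s - x) ^ a) / A := by
    intro x
    simp only [hu, hA, sub_sub_cancel, mul_pow]
    field_simp
    ring
  have hp0 : ∫ x in (0 : ℝ)..s, p x = 0 := by
    have huv : ∫ x in (0 : ℝ)..s, u x = ∫ x in (0 : ℝ)..s, v x := by
      simp only [hu, hv, intervalIntegral_pow_mul_sub_pow_eq]
      have : k + a + (k + b) = k + (k + a + b) := by ring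
      rw [this]
    simp only [hp, hw]
    have huu : Continuous fun x => u x + u (s - x) := huc.add huc'
    have hvv : Continuous fun x => v x + v (s - x) := hvc.add hvc'
    rw [intervalIntegral.integral_sub (huu.intervalIntegrable _ _) (hvv.intervalIntegrable _ _),
      intervalIntegral.integral_add (huc.intervalIntegrable _ _) (huc'.intervalIntegrable _ _),
      intervalIntegral.integral_add (hvc.intervalIntegrable _ _) (hvc'.intervalIntegrable _ _),
      refl u, refl v, huv, sub_self]
  have hw0 : 0 < ∫ x in (0 : ℝ)..s, w x := by
    refine intervalIntegral.intervalIntegral_pos_of_pos_on (hwc.intervalIntegrable _ _) ?_ hs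
    intro x hx
    have h1 : 0 < x := hx.1
    have h2 : 0 < s - x := sub_pos.2 hx.2
    rw [hw_eq]
    positivity
  have mono : ∀ x ∈ Set.Icc 0 s, ∀ y ∈ Set.Icc 0 s, y * (s - y) < x * (s - x) →
      0 ≤ (p x * w y - p y * w x) * (g x - g y) := by
    intro x hx y hy hxy
    have hx' : 0 ≤ s - x := sub_nonneg.2 hx.2
    have hy' : 0 ≤ s - y := sub_nonneg.2 hy.2
    refine mul_nonneg ?_ (sub_nonneg.2
      (hf.mul_le_mul_of_add_eq hy.1 hy' (by ring) hxy.le))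
    have h := mixed_pow_mul_le hx.1 hx' hy.1 hy' (by linarith) (by ring) hxy a b
    simp only [hp]
    rw [hu_eq, hu_eq, hw_eq, hw_eq]
    have e : ∀ X Y M N E F : ℝ, (X * M / A - X * E / B) * (Y * F / B) -
        (Y * N / A - Y * F / B) * (X * E / B) = X * Y * (M * F - N * E) / (A * B) := by
      intros; field_simp; ring
    rw [e]
    have := sub_nonneg.2 h
    have := hx.1
    have := hy.1
    positivity
  have key : 0 ≤ ∫ x in Set.Icc 0 s, p x * g x := by
    refine integral_mul_nonneg_of_monovary (w := w)
      (hpc.continuousOn.integrableOn_compact isCompact_Icc)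
      (hwc.continuousOn.integrableOn_compact isCompact_Icc) (int p hpc) (int w hwc) ?_
      (by rw [toI, hp0]) (by rwa [toI])
    filter_upwards [ae_restrict_mem measurableSet_Icc] with x hx
    filter_upwards [ae_restrict_mem measurableSet_Icc] with y hy
    rcases lt_trichotomy (y * (s - y)) (x * (s - x)) with h | h | h
    · exact mono x hx y hy h
    -- Here y is x or its reflection, and g takes the same value at both.
    · have : (x - y) * (x - (s - y)) = 0 := by linarith
      rcases mul_eq_zero.1 this with h | h
      · rw [sub_eq_zero.1 h]; simp
      · rw [sub_eq_zero.1 h, gsymm]; simp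
    · have := mono y hy x hx h
      linarith
  have split : ∫ x in (0 : ℝ)..s, p x * g x =
      2 * ((∫ x in (0 : ℝ)..s, u x * g x) - ∫ x in (0 : ℝ)..s, v x * g x) := by
    have e : ∀ x, p x * g x = (u x * g x + u (s - x) * g (s - x)) -
        (v x * g x + v (s - x) * g (s - x)) := by
      intro x
      rw [gsymm]; simp only [hp, hw]; ring
    have iu' : IntervalIntegrable (fun x => u (s - x) * g (s - x)) volume 0 s := by
      simp only [gsymm]; exact intI _ huc'
    have iv' : IntervalIntegrable (fun x => v (s - x) * g (s - x)) volume 0 s := by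
      simp only [gsymm]; exact intI _ hvc'
    have iu : IntervalIntegrable (fun x => u x * g x + u (s - x) * g (s - x)) volume 0 s :=
      (intI u huc).add iu'
    have iv : IntervalIntegrable (fun x => v x * g x + v (s - x) * g (s - x)) volume 0 s :=
      (intI v hvc).add iv'
    simp only [e]
    rw [intervalIntegral.integral_sub iu iv,
      intervalIntegral.integral_add (intI u huc) iu',
      intervalIntegral.integral_add (intI v hvc) iv',
      refl (fun x => u x * g x), refl (fun x => v x * g x)]
    ring
  rw [toI, split] at key
  linarith

/-! ### Moment measures and the order between their convolutions. -/

/-- The measure `x ^ j / j! dμ(x)` for `μ` living on `[0, ∞)`. -/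
noncomputable def momentMeasure (μ : Measure ℝ) (j : ℕ) : Measure ℝ :=
  μ.withDensity fun x => ENNReal.ofReal (x ^ j / (j.factorial : ℝ))

theorem measurable_ofReal_pow_div_factorial (j : ℕ) :
    Measurable fun x : ℝ => ENNReal.ofReal (x ^ j / (j.factorial : ℝ)) := by
  fun_prop

/-- Log-convexity of the factorial; it settles the point-mass case. -/
theorem factorial_add_mul_factorial_add_le (k a b : ℕ) :
    (k + a).factorial * (k + b).factorial ≤ k.factorial * (k + a + b).factorial := by
  induction a with
  | zero => simp
  | succ a ih =>
    have e : k + (a + 1) + b = k + a + b + 1 := by ring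
    rw [← add_assoc, Nat.factorial_succ, show k + a + 1 + b = k + a + b + 1 by ring,
      Nat.factorial_succ]
    calc (k + a + 1) * (k + a).factorial * (k + b).factorial
        = (k + a + 1) * ((k + a).factorial * (k + b).factorial) := by ring
      _ ≤ (k + a + b + 1) * (k.factorial * (k + a + b).factorial) :=
          Nat.mul_le_mul (by omega) ih
      _ = _ := by ring

theorem momentMeasure_smul_dirac (c : NNReal) (x₀ : ℝ) (j : ℕ) :
    momentMeasure (c • Measure.dirac x₀) j =
      ((c : ENNReal) * ENNReal.ofReal (x₀ ^ j / j.factorial)) • Measure.dirac x₀ := by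
  have : c • Measure.dirac x₀ = (c : ENNReal) • Measure.dirac x₀ := rfl
  rw [momentMeasure, this, withDensity_smul_measure, dirac_withDensity, smul_smul]

theorem momentMeasure_conv_le_of_dirac (c : NNReal) {x₀ : ℝ} (hx₀ : 0 ≤ x₀) (k a b : ℕ) :
    momentMeasure (c • Measure.dirac x₀) k ∗ momentMeasure (c • Measure.dirac x₀) (k + a + b) ≤
      momentMeasure (c • Measure.dirac x₀) (k + a) ∗
        momentMeasure (c • Measure.dirac x₀) (k + b) := by
  simp only [momentMeasure_smul_dirac, Measure.conv_smul_left, Measure.conv_smul_right,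
    Measure.dirac_conv_dirac, smul_smul]
  have key : ENNReal.ofReal (x₀ ^ k / k.factorial) *
      ENNReal.ofReal (x₀ ^ (k + a + b) / (k + a + b).factorial) ≤
      ENNReal.ofReal (x₀ ^ (k + a) / (k + a).factorial) *
      ENNReal.ofReal (x₀ ^ (k + b) / (k + b).factorial) := by
    rw [← ENNReal.ofReal_mul (by positivity), ← ENNReal.ofReal_mul (by positivity)]
    refine ENNReal.ofReal_le_ofReal ?_
    rw [div_mul_div_comm, div_mul_div_comm, ← pow_add, ← pow_add,
      show k + (k + a + b) = k + a + (k + b) by ring]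
    refine div_le_div_of_nonneg_left (by positivity) (by positivity) ?_
    exact_mod_cast factorial_add_mul_factorial_add_le k a b
  refine Measure.le_iff.2 fun s _ => ?_
  simp only [Measure.smul_apply, smul_eq_mul]
  refine mul_le_mul_left ?_ _
  calc _ = (c : ENNReal) * c * (ENNReal.ofReal (x₀ ^ k / k.factorial) *
      ENNReal.ofReal (x₀ ^ (k + a + b) / (k + a + b).factorial)) := by ring
    _ ≤ (c : ENNReal) * c * (ENNReal.ofReal (x₀ ^ (k + a) / (k + a).factorial) *
      ENNReal.ofReal (x₀ ^ (k + b) / (k + b).factorial)) := mul_le_mul_right key _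
    _ = _ := by ring

theorem momentMeasure_withDensity {f : ℝ → ℝ} (hf : LogConcaveFunOn (Set.Ici 0) f) (j : ℕ) :
    momentMeasure ((volume.restrict (Set.Ici 0)).withDensity fun x => ENNReal.ofReal (f x)) j =
      volume.withDensity ((Set.Ici (0 : ℝ)).indicator fun x =>
        ENNReal.ofReal (x ^ j / j.factorial * f x)) := by
  have hF := hf.measurable_indicator
  have e : (volume.restrict (Set.Ici (0 : ℝ))).withDensity (fun x => ENNReal.ofReal (f x)) =
      volume.withDensity fun x => ENNReal.ofReal ((Set.Ici (0 : ℝ)).indicator f x) := by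
    rw [← withDensity_indicator measurableSet_Ici]
    congr 1
    ext x
    by_cases hx : x ∈ Set.Ici (0 : ℝ) <;> simp [hx]
  rw [momentMeasure, e, ← withDensity_mul _ hF.ennreal_ofReal
    (measurable_ofReal_pow_div_factorial j)]
  congr 1
  ext x
  by_cases hx : x ∈ Set.Ici (0 : ℝ)
  · have : 0 ≤ x := hx
    simp only [Pi.mul_apply, Set.indicator_of_mem hx]
    rw [mul_comm, ENNReal.ofReal_mul (by positivity)]
  · simp [hx]

theorem measurable_indicator_ofReal_pow_mul {f : ℝ → ℝ} (hf : LogConcaveFunOn (Set.Ici 0) f)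
    (j : ℕ) : Measurable ((Set.Ici (0 : ℝ)).indicator fun x =>
      ENNReal.ofReal (x ^ j / j.factorial * f x)) := by
  have hF := hf.measurable_indicator
  have : Measurable fun x : ℝ => ENNReal.ofReal (x ^ j / j.factorial *
      (Set.Ici (0 : ℝ)).indicator f x) := by fun_prop
  convert this using 2 with x
  by_cases hx : x ∈ Set.Ici (0 : ℝ) <;> simp [hx]

theorem LogConcaveFunOn.lconvolution_eq {f : ℝ → ℝ} (hf : LogConcaveFunOn (Set.Ici 0) f)
    {s : ℝ} (hs : 0 < s) (i j : ℕ) :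
    ∫⁻ y, (Set.Ici (0 : ℝ)).indicator (fun x => ENNReal.ofReal (x ^ i / i.factorial * f x)) y *
        (Set.Ici (0 : ℝ)).indicator (fun x => ENNReal.ofReal (x ^ j / j.factorial * f x))
          (-y + s) =
      ENNReal.ofReal (∫ x in (0 : ℝ)..s,
        x ^ i / i.factorial * ((s - x) ^ j / j.factorial) * (f x * f (s - x))) := by
  rw [intervalIntegral.integral_of_le hs.le, ← integral_Icc_eq_integral_Ioc,
    ofReal_integral_eq_lintegral_ofReal (hf.integrable_mul_reflect s (by fun_prop)),
    ← lintegral_indicator measurableSet_Icc]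
  · refine lintegral_congr fun y => ?_
    by_cases hy : y ∈ Set.Icc 0 s
    · have h0 : 0 ≤ y := hy.1
      have h1 : 0 ≤ s - y := sub_nonneg.2 hy.2
      have := hf.1 _ h0
      have := hf.1 _ h1
      rw [neg_add_eq_sub, Set.indicator_of_mem (show y ∈ Set.Ici (0 : ℝ) from h0),
        Set.indicator_of_mem (show s - y ∈ Set.Ici (0 : ℝ) from h1), Set.indicator_of_mem hy,
        ← ENNReal.ofReal_mul (by positivity)]
      congr 1
      ring
    · rw [Set.indicator_of_notMem hy]
      by_cases h0 : y ∈ Set.Ici (0 : ℝ)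
      · rw [Set.indicator_of_notMem (a := -y + s), mul_zero]
        intro h1
        have h1 : 0 ≤ -y + s := h1
        exact hy ⟨h0, by linarith⟩
      · rw [Set.indicator_of_notMem h0, zero_mul]
  · filter_upwards [ae_restrict_mem measurableSet_Icc] with x hx
    have h0 : 0 ≤ x := hx.1
    have h1 : 0 ≤ s - x := sub_nonneg.2 hx.2
    have := hf.1 _ h0
    have := hf.1 _ h1
    simp only [Pi.zero_apply]
    positivity

theorem LogConcaveFunOn.momentMeasure_conv_le {f : ℝ → ℝ}
    (hf : LogConcaveFunOn (Set.Ici 0) f) {μ : Measure ℝ}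
    (hμ : μ = (volume.restrict (Set.Ici 0)).withDensity fun x => ENNReal.ofReal (f x))
    (k a b : ℕ) :
    momentMeasure μ k ∗ momentMeasure μ (k + a + b) ≤
      momentMeasure μ (k + a) ∗ momentMeasure μ (k + b) := by
  subst hμ
  simp only [momentMeasure_withDensity hf]
  rw [conv_withDensity_eq_lconvolution (measurable_indicator_ofReal_pow_mul hf _)
      (measurable_indicator_ofReal_pow_mul hf _),
    conv_withDensity_eq_lconvolution (measurable_indicator_ofReal_pow_mul hf _)
      (measurable_indicator_ofReal_pow_mul hf _)]
  refine withDensity_mono ?_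
  filter_upwards [Measure.ae_ne volume (0 : ℝ)] with s hs
  rw [lconvolution_def, lconvolution_def]
  rcases hs.lt_or_gt with hs | hs
  · refine le_of_eq_of_le ?_ zero_le
    rw [lintegral_eq_zero_of_ae_eq_zero]
    refine Filter.Eventually.of_forall fun y => ?_
    simp only [Pi.zero_apply]
    by_cases h0 : y ∈ Set.Ici (0 : ℝ)
    · rw [Set.indicator_of_notMem (a := -y + s), mul_zero]
      intro h1
      have h1 : 0 ≤ -y + s := h1
      have h0 : 0 ≤ y := h0
      linarith
    · rw [Set.indicator_of_notMem h0, zero_mul]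
  · rw [hf.lconvolution_eq hs, hf.lconvolution_eq hs]
    exact ENNReal.ofReal_le_ofReal (hf.intervalIntegral_pow_mul_le hs k a b)

theorem IsLogConcaveMeasure.momentMeasure_conv_le {μ : Measure ℝ} (hμ : IsLogConcaveMeasure μ)
    (k a b : ℕ) :
    momentMeasure μ k ∗ momentMeasure μ (k + a + b) ≤
      momentMeasure μ (k + a) ∗ momentMeasure μ (k + b) := by
  obtain ⟨c, x₀, hx₀, rfl⟩ | ⟨f, hf, h⟩ := hμ
  · exact momentMeasure_conv_le_of_dirac c hx₀ k a b
  · exact hf.momentMeasure_conv_le h k a b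

/-! ### Support and exponential moments. -/

theorem IsLogConcaveMeasure.measure_Iio {μ : Measure ℝ} (hμ : IsLogConcaveMeasure μ) :
    μ (Set.Iio 0) = 0 := by
  obtain ⟨c, x₀, hx₀, rfl⟩ | ⟨f, hf, rfl⟩ := hμ
  · simp [hx₀]
  · refine withDensity_absolutelyContinuous _ _ ?_
    rw [Measure.restrict_apply measurableSet_Iio]
    have : Set.Iio (0 : ℝ) ∩ Set.Ici 0 = ∅ := by ext; simp
    simp [this]

open ProbabilityTheory in
/-- Finite log-concave measures on the half-line have exponential moments. -/
theorem IsLogConcaveMeasure.zero_mem_interior_integrableExpSet {μ : Measure ℝ}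
    [IsFiniteMeasure μ] (hμ : IsLogConcaveMeasure μ) :
    (0 : ℝ) ∈ interior (integrableExpSet id μ) := by
  obtain ⟨c, x₀, hx₀, rfl⟩ | ⟨f, hf, h⟩ := hμ
  · have : integrableExpSet id (c • Measure.dirac x₀) = Set.univ := by
      refine Set.eq_univ_of_forall fun t => ?_
      have : Integrable (fun x : ℝ => Real.exp (t * id x)) (Measure.dirac x₀) :=
        integrable_dirac (by simp)
      exact this.smul_measure_nnreal
    simp [this]
  · have hfm : AEMeasurable f (volume.restrict (Set.Ici 0)) := by
      refine hf.measurable_indicator.aemeasurable.congr ?_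
      filter_upwards [ae_restrict_mem measurableSet_Ici] with x hx
      rw [Set.indicator_of_mem hx]
    have hf0 : ∀ᵐ x ∂(volume.restrict (Set.Ici (0 : ℝ))), 0 ≤ f x := by
      filter_upwards [ae_restrict_mem measurableSet_Ici] with x hx using hf.1 x hx
    have hint : IntegrableOn f (Set.Ici 0) := by
      refine (lintegral_ofReal_ne_top_iff_integrable hfm.aestronglyMeasurable hf0).1 ?_
      have := measure_ne_top μ Set.univ
      rwa [h, withDensity_apply _ MeasurableSet.univ, Measure.restrict_univ] at this
    obtain ⟨c, hc, hexp⟩ := hf.exists_integrableOn_mul_exp hint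
    refine mem_interior.2 ⟨Set.Iio c, fun t ht => ?_, isOpen_Iio, hc⟩
    have hi := hexp t ht
    change Integrable _ μ
    rw [h, integrable_withDensity_iff_integrable_smul₀' hfm.ennreal_ofReal
      (Filter.Eventually.of_forall fun _ => ENNReal.ofReal_lt_top)]
    refine hi.congr ?_
    filter_upwards [hf0] with x hx
    simp [ENNReal.toReal_ofReal hx, mul_comm]

/-! ### Transforms of moment measures and convolutions. -/

theorem isFiniteMeasure_momentMeasure {μ : Measure ℝ} {j : ℕ}
    (h : MemLp id j μ) [IsFiniteMeasure μ] : IsFiniteMeasure (momentMeasure μ j) := by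
  refine isFiniteMeasure_withDensity_ofReal ?_
  have h1 : Integrable (fun x : ℝ => ‖x ^ j‖) μ := by
    simpa only [id, norm_pow] using h.integrable_norm_pow'
  exact (((integrable_norm_iff (by fun_prop)).1 h1).div_const _).2

theorem momentMeasure_Iio {μ : Measure ℝ} (h : μ (Set.Iio 0) = 0) (j : ℕ) :
    momentMeasure μ j (Set.Iio 0) = 0 :=
  withDensity_absolutelyContinuous _ _ h

theorem integral_momentMeasure {μ : Measure ℝ} (h : μ (Set.Iio 0) = 0) (j : ℕ) {𝕜 : Type*}
    [RCLike 𝕜] (φ : ℝ → 𝕜) :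
    ∫ x, φ x ∂(momentMeasure μ j) = ∫ x, ((x ^ j / j.factorial : ℝ) : 𝕜) * φ x ∂μ := by
  rw [momentMeasure, integral_withDensity_eq_integral_toReal_smul
    (measurable_ofReal_pow_div_factorial j)
    (Filter.Eventually.of_forall fun _ => ENNReal.ofReal_lt_top)]
  refine integral_congr_ae ?_
  filter_upwards [ae_nonneg_of_measure_Iio h] with x hx
  rw [ENNReal.toReal_ofReal (by positivity), RCLike.real_smul_eq_coe_mul]

theorem conv_Iio {α β : Measure ℝ} [SFinite α] [SFinite β] (hα : α (Set.Iio 0) = 0)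
    (hβ : β (Set.Iio 0) = 0) : (α ∗ β) (Set.Iio 0) = 0 := by
  have h : ∀ᵐ p ∂(α.prod β), 0 ≤ p.1 + p.2 := by
    filter_upwards [Measure.quasiMeasurePreserving_fst.ae (ae_nonneg_of_measure_Iio hα),
      Measure.quasiMeasurePreserving_snd.ae (ae_nonneg_of_measure_Iio hβ)] with p h1 h2
    exact add_nonneg h1 h2
  rw [Measure.conv, Measure.map_apply (by fun_prop) measurableSet_Iio]
  rw [ae_iff] at h
  simpa [Set.preimage] using h

theorem integral_conv_of_map_add {α β : Measure ℝ} [SFinite α] [SFinite β] {𝕜 : Type*} [RCLike 𝕜]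
    {φ : ℝ → 𝕜} (hφ : Continuous φ) (hadd : ∀ x y, φ (x + y) = φ x * φ y) :
    ∫ x, φ x ∂(α ∗ β) = (∫ x, φ x ∂α) * ∫ x, φ x ∂β := by
  rw [Measure.conv, integral_map (by fun_prop) hφ.aestronglyMeasurable]
  simp only [hadd]
  exact integral_prod_mul φ φ

theorem fourierMeasure_eq_charFun (μ : Measure ℝ) :
    fourierMeasure μ = fun t => charFun μ (-t) := by
  ext t
  rw [fourierMeasure, charFun_apply_real]
  congr! 3 with x
  push_cast
  ring

theorem contDiff_fourierMeasure {μ : Measure ℝ} [IsFiniteMeasure μ]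
    (h : ∀ j : ℕ, MemLp id j μ) : ContDiff ℝ (⊤ : ℕ∞) (fourierMeasure μ) := by
  rw [fourierMeasure_eq_charFun]
  exact (contDiff_charFun' h).comp contDiff_neg

/-- Each derivative brings down a factor -ix; the sign comes from F_μ(t) being the characteristic
function at -t. -/
theorem iteratedDeriv_fourierMeasure {μ : Measure ℝ} [IsFiniteMeasure μ]
    (hμ : μ (Set.Iio 0) = 0) {j : ℕ} (h : MemLp id j μ) (t : ℝ) :
    iteratedDeriv j (fourierMeasure μ) t / (j.factorial : ℂ) =
      (-Complex.I) ^ j * fourierMeasure (momentMeasure μ j) t := by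
  rw [fourierMeasure_eq_charFun μ, iteratedDeriv_comp_neg, iteratedDeriv_charFun h,
    fourierMeasure, integral_momentMeasure hμ, neg_pow Complex.I]
  have : ∀ x : ℝ, ((x ^ j / j.factorial : ℝ) : ℂ) * Complex.exp (-(Complex.I * t * x)) =
      (x : ℂ) ^ j * Complex.exp (((-t : ℝ) : ℂ) * x * Complex.I) / j.factorial := by
    intro x
    push_cast
    rw [div_mul_eq_mul_div]
    ring_nf
  have e : ∫ x : ℝ, ((x ^ j / j.factorial : ℝ) : ℂ) * Complex.exp (-(Complex.I * t * x)) ∂μ =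
      (∫ x : ℝ, (x : ℂ) ^ j * Complex.exp (((-t : ℝ) : ℂ) * x * Complex.I) ∂μ) /
        j.factorial := by
    simp only [this]
    exact integral_div _ _
  refine Eq.trans ?_ (congrArg ((-1) ^ j * Complex.I ^ j * ·) e.symm)
  simp only [Complex.real_smul]
  push_cast
  ring

theorem taylorCoeff_eq_integral_momentMeasure {μ : Measure ℝ} (hμ : μ (Set.Iio 0) = 0) (t : ℝ)
    (j : ℕ) : taylorCoeff μ t j = ∫ x, Real.exp (-(t * x)) ∂(momentMeasure μ j) := by
  rw [integral_momentMeasure hμ]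
  rfl

/-! ### The Berwald–Borell transform. -/

theorem mainTheorem10 (μ : Measure ℝ) [IsFiniteMeasure μ] (hμ : IsLogConcaveMeasure μ)
    (k l m n : ℕ) (hkl : k ≤ l) (hlm : l ≤ m) (hmn : m ≤ n) (hsum : k + n = l + m) :
    ContDiff ℝ (⊤ : ℕ∞) (fourierMeasure μ) ∧
    ∃ ν : Measure ℝ, IsBerwaldBorellTransform μ k l m n ν ∧
      (∀ ν' : Measure ℝ, IsBerwaldBorellTransform μ k l m n ν' → ν' = ν) ∧
      ∀ t : ℝ,
        iteratedDeriv l (fourierMeasure μ) t / (l.factorial : ℂ) *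
            (iteratedDeriv m (fourierMeasure μ) t / (m.factorial : ℂ)) -
          iteratedDeriv k (fourierMeasure μ) t / (k.factorial : ℂ) *
            (iteratedDeriv n (fourierMeasure μ) t / (n.factorial : ℂ)) =
        (-Complex.I) ^ (l + m) * fourierMeasure ν t := by
  have hLp : ∀ j : ℕ, MemLp id j μ := fun j => by
    exact_mod_cast ProbabilityTheory.memLp_of_mem_interior_integrableExpSet
      hμ.zero_mem_interior_integrableExpSet (j : NNReal)
  have hneg := hμ.measure_Iio
  have hfin : ∀ j, IsFiniteMeasure (momentMeasure μ j) := fun j =>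
    isFiniteMeasure_momentMeasure (hLp j)
  refine ⟨contDiff_fourierMeasure hLp, ?_⟩
  have hle : momentMeasure μ k ∗ momentMeasure μ n ≤ momentMeasure μ l ∗ momentMeasure μ m := by
    obtain ⟨a, rfl⟩ := Nat.exists_eq_add_of_le hkl
    obtain ⟨b, rfl⟩ := Nat.exists_eq_add_of_le (hkl.trans hlm)
    obtain rfl : n = k + a + b := by omega
    exact hμ.momentMeasure_conv_le k a b
  set ρ := momentMeasure μ l ∗ momentMeasure μ m
  set σ := momentMeasure μ k ∗ momentMeasure μ n
  -- Subtraction of measures is truncated; `hle` makes it a true difference.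
  have hν : ρ - σ + σ = ρ := Measure.sub_add_cancel_of_le hle
  have hνle : ρ - σ ≤ ρ := Measure.sub_le
  have hρneg : ρ (Set.Iio 0) = 0 := conv_Iio (momentMeasure_Iio hneg l) (momentMeasure_Iio hneg m)
  have hσneg : σ (Set.Iio 0) = 0 := conv_Iio (momentMeasure_Iio hneg k) (momentMeasure_Iio hneg n)
  have hνneg : (ρ - σ) (Set.Iio 0) = 0 := le_antisymm ((hνle _).trans hρneg.le) zero_le
  have hνfin : IsFiniteMeasure (ρ - σ) := isFiniteMeasure_of_le ρ hνle
  -- One identity for multiplicative φ serves both the real Laplace kernel and the complex Fourier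
  -- kernel.
  have hint : ∀ {𝕜 : Type} [RCLike 𝕜] (φ : ℝ → 𝕜), Continuous φ → (∀ x, 0 ≤ x → ‖φ x‖ ≤ 1) →
      (∀ x y, φ (x + y) = φ x * φ y) →
      ∫ x, φ x ∂(ρ - σ) =
        (∫ x, φ x ∂(momentMeasure μ l)) * (∫ x, φ x ∂(momentMeasure μ m)) -
        (∫ x, φ x ∂(momentMeasure μ k)) * ∫ x, φ x ∂(momentMeasure μ n) := by
    intro 𝕜 _ φ hφ hb hadd
    have hi : ∀ τ : Measure ℝ, IsFiniteMeasure τ → τ (Set.Iio 0) = 0 → Integrable φ τ := by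
      intro τ _ hτ
      refine Integrable.of_bound (C := 1) hφ.aestronglyMeasurable ?_
      filter_upwards [ae_nonneg_of_measure_Iio hτ] with x hx using hb x hx
    rw [← integral_conv_of_map_add hφ hadd, ← integral_conv_of_map_add hφ hadd, eq_sub_iff_add_eq]
    change ∫ x, φ x ∂(ρ - σ) + ∫ x, φ x ∂σ = ∫ x, φ x ∂ρ
    rw [← integral_add_measure (hi _ hνfin hνneg) (hi _ inferInstance hσneg), hν]
  have hBB : IsBerwaldBorellTransform μ k l m n (ρ - σ) := by
    refine ⟨hνfin, hνneg, fun t ht => ?_⟩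
    simp only [taylorCoeff_eq_integral_momentMeasure hneg]
    refine hint (fun x => Real.exp (-(t * x))) (by fun_prop) (fun x hx => ?_) (fun x y => ?_)
    · rw [Real.norm_of_nonneg (Real.exp_nonneg _), ← neg_mul]
      exact exp_mul_le_one_of_nonneg hx (by linarith)
    · rw [← Real.exp_add]; ring_nf
  refine ⟨ρ - σ, hBB, fun ν' h' => ?_, fun t => ?_⟩
  · have := h'.finite
    exact Measure.ext_of_laplace_eq h'.neg_null hνneg fun t ht => by
      rw [h'.laplace t ht, hBB.laplace t ht]
  · have h := hint (fun x : ℝ => Complex.exp (-(Complex.I * t * x))) (by fun_prop)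
      (fun x _ => by simp [Complex.norm_exp])
      (fun x y => by rw [← Complex.exp_add]; push_cast; ring_nf)
    simp only [iteratedDeriv_fourierMeasure hneg (hLp _)]
    rw [show fourierMeasure (ρ - σ) t = _ from h]
    -- Since k + n = l + m, both products carry the same phase, which factors out.
    have hpow : (-Complex.I) ^ k * (-Complex.I) ^ n = (-Complex.I) ^ l * (-Complex.I) ^ m := by
      rw [← pow_add, ← pow_add, hsum]
    simp only [fourierMeasure]
    rw [mul_mul_mul_comm, mul_mul_mul_comm ((-Complex.I) ^ k), hpow, pow_add, mul_sub]
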